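/- Let $G=((V,E),(V_\exists,V_\forall,V_R),\Delta)$ be a finite stochastic arena: $V$ is a finite set partitioned into the vertices $V_\exists$ of Eve, $V_\forall$ of Adam and random vertices $V_R$; every vertex has a successor in the edge relation $E$; and for $u\in V_R$, $\Delta(u,\cdot)$ is a probability distribution on $V$ with support $\{v \mid (u,v)\in E\}$. Let $p:V\to\mathbb N$ be a priority function, and let $\alpha:\mathbb N\to[0,1]$ be monotonically decreasing (not necessarily strictly). Put $n=|V|$ and let $\delta_{\min}$ be the least positive value $\Delta(u,v)$, $u\in V_R$, $v\in V$ (with $\delta_{\min}=1$ if $V_R=\emptyset$). The arena $\widetilde G$ has the vertices $\overline v,\widehat v$ ($v\in V$) and two sinks $v_{\rm win},v_{\rm lose}$. The vertex $\overline v$ has the owner of $v$; all other vertices are random. A move from $u$ to $v$ in $G$ becomes a move from $\overline u$ to $\widehat v$, with the same probability $\Delta(u,v)$ if $u$ is random. From $\widehat v$ the play moves to $\overline v$ with probability $1-\alpha_{p(v)}$, and with probability $\alpha_{p(v)}$ to $v_{\rm win}$ if $p(v)$ is even, to $v_{\rm lose}$ if $p(v)$ is odd. Both sinks are absorbing. A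 pure memoryless strategy of Eve (Adam) chooses one successor of each vertex of $V_\exists$ ($V_\forall$); strategies in $G$ are identified with strategies in $\widetilde G$. A pair $(\sigma,\gamma)$ of such strategies for Eve and Adam turns $G$ and $\widetilde G$ into finite Markov chains $G_{\sigma,\gamma}$ and $\widetilde G_{\sigma,\gamma}$. For a bottom strongly connected component (BSCC) $U$ of $G_{\sigma,\gamma}$, let $\widetilde U=\{\overline v,\widehat v\mid v\in U\}$ be the associated pBSCC. For $k\in\mathbb N$ put $x_2=\delta_{\min}(1-\alpha_{k+1})$, $x_3=(1-\delta_{\min})(1-\alpha_{k+1})$, $x_4=\delta_{\min}\alpha_k$, $x_5=\delta_{\min}(1-\alpha_k)+(1-\delta_{\min})(1-\alpha_{k+1})$, $t=x_3$, and $$ B_k=(1-\alpha_{k+1})\cdot\frac{(1-x_2)\,x_2^{\,n-1}\,x_4}{1-(x_2+x_3)+x_5x_2^{\,n}+t\,x_2^{\,n-1}-x_5x_2^{\,n-1}}, $$ where the fraction is read as $0$ if its denominator vanishes (which happens only if $\alpha_{k+1}=0$ and in addition $\alpha_k=0$ or $\delta_{\min}=1$). Then for every pair $(\sigma,\gamma)$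 of pure memoryless strategies, every BSCC $U$ of $G_{\sigma,\gamma}$, and $k=\min p(U)$: - if $k$ is even, then $\displaystyle\min_{x\in\widetilde U}\Pr\nolimits^{x}_{\widetilde G_{\sigma,\gamma}}(\text{reach }v_{\rm win})\ \ge\ B_k$; - if $k$ is odd, then $\displaystyle\max_{x\in\widetilde U}\Pr\nolimits^{x}_{\widetilde G_{\sigma,\gamma}}(\text{reach }v_{\rm win})\ \le\ 1-B_k$. -/

import Mathlib

/-- A discrete-time Markov chain with finite state space `S` (initial state left free). -/
structure MarkovChain (S : Type*) [Fintype S] where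
  δ : S → S → ℝ
  δ_nonneg : ∀ s t, 0 ≤ δ s t
  δ_sum : ∀ s, ∑ t, δ s t = 1

namespace MarkovChain

variable {S : Type*} [Fintype S]

/-- The probability `∏ δ(wᵢ, wᵢ₊₁)` of a finite path `w₀ w₁ … wₙ`. -/
def pathProb (M : MarkovChain S) {n : ℕ} (w : Fin (n + 1) → S) : ℝ :=
  ∏ i : Fin n, M.δ (w i.castSucc) (w i.succ)

/-- `w₀ w₁ … wₙ` starts in `s` and lies in `(S \ T)* T`. Sequences that use a transition of
probability `0` are not excluded here; they have `pathProb` zero. -/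
def IsFirstHit (s : S) (T : Set S) {n : ℕ} (w : Fin (n + 1) → S) : Prop :=
  w 0 = s ∧ (∀ i : Fin n, w i.castSucc ∉ T) ∧ w (Fin.last n) ∈ T

open Classical in
/-- Probability that `T` is reached from `s` for the first time after exactly `n` steps. -/
noncomputable def hitProb (M : MarkovChain S) (s : S) (T : Set S) (n : ℕ) : ℝ :=
  ∑ w : Fin (n + 1) → S with IsFirstHit s T w, M.pathProb w

/-- Probability of reaching `T` from `s`: the total probability of all finite paths from `s` in
`(S \ T)* T`. The series always converges, see `summable_hitProb`. -/
noncomputable def reachProb (M : MarkovChain S) (s : S) (T : Set S) : ℝ :=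
  ∑' n, M.hitProb s T n

/-- `t` is a possible next state after `s`. -/
def Step (M : MarkovChain S) (s t : S) : Prop := 0 < M.δ s t

/-- All pairs of states of `L` are (mutually) reachable, by paths with at least one step. -/
def IsStronglyConnected (M : MarkovChain S) (L : Set S) : Prop :=
  ∀ s ∈ L, ∀ t ∈ L, Relation.TransGen M.Step s t

/-- A strongly connected component: a nonempty, maximal strongly connected set. -/
def IsSCC (M : MarkovChain S) (L : Set S) : Prop :=
  L.Nonempty ∧ M.IsStronglyConnected L ∧ ∀ L', L ⊆ L' → M.IsStronglyConnected L' → L' = L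

/-- A bottom strongly connected component: an SCC that no transition leaves. -/
def IsBSCC (M : MarkovChain S) (L : Set S) : Prop :=
  M.IsSCC L ∧ ∀ s ∈ L, ∀ t, t ∉ L → ¬ M.Step s t

theorem hitProb_nonneg (M : MarkovChain S) (s : S) (T : Set S) (n : ℕ) :
    0 ≤ M.hitProb s T n :=
  Finset.sum_nonneg fun _ _ => Finset.prod_nonneg fun _ _ => M.δ_nonneg _ _

theorem hitProb_zero (M : MarkovChain S) (s : S) (T : Set S) [Decidable (s ∈ T)] :
    M.hitProb s T 0 = if s ∈ T then 1 else 0 := by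
  classical
  have h : ∀ w : Fin (0 + 1) → S, IsFirstHit s T w ↔ w = (fun _ => s) ∧ s ∈ T := by
    intro w
    constructor
    · rintro ⟨h0, -, h1⟩
      refine ⟨funext fun i => ?_, ?_⟩
      · rw [show i = 0 from Fin.ext (by omega), h0]
      · rw [← h0]; exact h1
    · rintro ⟨rfl, h⟩
      exact ⟨rfl, fun i => i.elim0, h⟩
  unfold hitProb
  by_cases hs : s ∈ T
  · rw [if_pos hs, Finset.sum_eq_single (fun _ => s)]
    · simp [pathProb]
    · intro w hw hne
      exact absurd ((h w).1 (Finset.mem_filter.1 hw).2).1 hne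
    · intro hw
      exact absurd (Finset.mem_filter.2 ⟨Finset.mem_univ _, (h _).2 ⟨rfl, hs⟩⟩) hw
  · rw [if_neg hs]
    apply Finset.sum_eq_zero
    intro w hw
    exact absurd ((h w).1 (Finset.mem_filter.1 hw).2).2 hs

theorem hitProb_succ (M : MarkovChain S) (s : S) (T : Set S) (n : ℕ) [Decidable (s ∈ T)] :
    M.hitProb s T (n + 1) = if s ∈ T then 0 else ∑ t, M.δ s t * M.hitProb t T n := by
  classical
  have h : ∀ (a : S) (w : Fin (n + 1) → S),
      IsFirstHit s T (Fin.cons a w : Fin (n + 1 + 1) → S) ↔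
        a = s ∧ s ∉ T ∧ IsFirstHit (w 0) T w := by
    intro a w
    have hlast : (Fin.cons a w : Fin (n + 1 + 1) → S) (Fin.last (n + 1)) = w (Fin.last n) := by
      rw [← Fin.succ_last, Fin.cons_succ]
    unfold IsFirstHit
    rw [Fin.forall_fin_succ, hlast]
    simp only [Fin.cons_zero, Fin.castSucc_zero, ← Fin.succ_castSucc, Fin.cons_succ, true_and]
    constructor
    · rintro ⟨rfl, ⟨h1, h2⟩, h3⟩
      exact ⟨rfl, h1, h2, h3⟩
    · rintro ⟨rfl, h1, h2, h3⟩
      exact ⟨rfl, ⟨h1, h2⟩, h3⟩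
  have hp : ∀ (a : S) (w : Fin (n + 1) → S),
      M.pathProb (Fin.cons a w : Fin (n + 1 + 1) → S) = M.δ a (w 0) * M.pathProb w := by
    intro a w
    unfold pathProb
    rw [Fin.prod_univ_succ]
    simp only [Fin.cons_zero, Fin.castSucc_zero, ← Fin.succ_castSucc, Fin.cons_succ]
  unfold hitProb
  rw [Finset.sum_filter, ← (Fin.consEquiv fun _ => S).sum_comp, Fintype.sum_prod_type]
  simp only [Fin.consEquiv, Equiv.coe_fn_mk, h, hp]
  rw [Finset.sum_eq_single s (by intro a _ ha; simp [ha]) (by simp)]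
  by_cases hs : s ∈ T
  · simp [hs]
  · simp only [hs, not_false_eq_true, true_and, if_false, Finset.sum_filter, Finset.mul_sum]
    rw [Finset.sum_comm]
    refine Finset.sum_congr rfl fun w _ => ?_
    rw [Finset.sum_eq_single (w 0)]
    · simp
    · intro t _ ht
      rw [if_neg (fun hw => ht hw.1.symm), mul_zero]
    · simp

theorem sum_hitProb_le_one (M : MarkovChain S) (T : Set S) (N : ℕ) :
    ∀ s, ∑ n ∈ Finset.range N, M.hitProb s T n ≤ 1 := by
  classical
  induction N with
  | zero => intro s; simp
  | succ N ih =>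
    intro s
    rw [Finset.sum_range_succ', hitProb_zero]
    simp only [hitProb_succ]
    by_cases hs : s ∈ T
    · simp [hs]
    · simp only [hs, if_false, add_zero]
      rw [Finset.sum_comm, ← M.δ_sum s]
      refine Finset.sum_le_sum fun t _ => ?_
      rw [← Finset.mul_sum]
      exact mul_le_of_le_one_right (M.δ_nonneg s t) (ih t)

theorem summable_hitProb (M : MarkovChain S) (s : S) (T : Set S) :
    Summable (M.hitProb s T) :=
  summable_of_sum_range_le (M.hitProb_nonneg s T) fun N => M.sum_hitProb_le_one T N s

end MarkovChain

/-- The three classes of the partition of the vertices of a stochastic arena. -/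
inductive Owner
  | eve
  | adam
  | random
  deriving DecidableEq

/-- A stochastic arena on the finite vertex set `V`. The values of `Δ` on vertices that are not
random carry no meaning and are never used. -/
structure StochasticArena (V : Type*) [Fintype V] where
  E : V → V → Prop
  owner : V → Owner
  Δ : V → V → ℝ
  Δ_nonneg : ∀ u, owner u = Owner.random → ∀ v, 0 ≤ Δ u v
  Δ_sum : ∀ u, owner u = Owner.random → ∑ v, Δ u v = 1
  edge_iff : ∀ u, owner u = Owner.random → ∀ v, (E u v ↔ 0 < Δ u v)
  nonblocking : ∀ u, ∃ v, E u v

namespace StochasticArena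

variable {V : Type*} [Fintype V]

/-- Pure memoryless strategies of Eve: a successor for each vertex of Eve. -/
def EveStrategy (G : StochasticArena V) : Type _ :=
  (u : {u : V // G.owner u = Owner.eve}) → {v : V // G.E u.1 v}

/-- Pure memoryless strategies of Adam: a successor for each vertex of Adam. -/
def AdamStrategy (G : StochasticArena V) : Type _ :=
  (u : {u : V // G.owner u = Owner.adam}) → {v : V // G.E u.1 v}

theorem owner_random (G : StochasticArena V) {u : V} (h : ¬ G.owner u = Owner.eve)
    (h' : ¬ G.owner u = Owner.adam) : G.owner u = Owner.random := by
  cases hu : G.owner u <;> simp_all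

variable [DecidableEq V]

/-- Transition probabilities after fixing pure memoryless strategies. -/
noncomputable def chainδ (G : StochasticArena V) (σ : G.EveStrategy) (γ : G.AdamStrategy)
    (u v : V) : ℝ :=
  if h : G.owner u = Owner.eve then (if (σ ⟨u, h⟩ : V) = v then 1 else 0)
  else if h : G.owner u = Owner.adam then (if (γ ⟨u, h⟩ : V) = v then 1 else 0)
  else G.Δ u v

/-- The Markov chain of the sub-arena obtained by fixing pure memoryless strategies. -/
noncomputable def chain (G : StochasticArena V) (σ : G.EveStrategy) (γ : G.AdamStrategy) :
    MarkovChain V where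
  δ := G.chainδ σ γ
  δ_nonneg u v := by
    unfold chainδ
    split_ifs with h₁ h₂ h₃ h₄
    all_goals first
      | exact zero_le_one
      | exact le_rfl
      | exact G.Δ_nonneg u (G.owner_random ‹_› ‹_›) v
  δ_sum u := by
    unfold chainδ
    by_cases h : G.owner u = Owner.eve
    · simp [h]
    · by_cases h' : G.owner u = Owner.adam
      · simp [h']
      · simpa [h, h'] using G.Δ_sum u (G.owner_random h h')

/-- The least positive transition probability of the arena. The moves of the players have
probability `1`, hence the inserted `1`, which matters only if no vertex is random. -/
noncomputable def deltaMin (G : StochasticArena V) : ℝ :=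
  (insert 1 ((Finset.univ.filter fun e : V × V =>
    G.owner e.1 = Owner.random ∧ 0 < G.Δ e.1 e.2).image fun e => G.Δ e.1 e.2)).min'
    (Finset.insert_nonempty _ _)

end StochasticArena

/-- The vertices of the reachability game: two copies of each vertex, and the two sinks. -/
inductive GadgetVertex (V : Type*)
  | bar (v : V)
  | hat (v : V)
  | win
  | lose
  deriving DecidableEq, Fintype

namespace StochasticArena

variable {V : Type*} [Fintype V]

theorem sum_gadgetVertex (f : GadgetVertex V → ℝ) :
    ∑ x, f x = ∑ v, f (.bar v) + ∑ v, f (.hat v) + f .win + f .lose := by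
  let e : (V ⊕ V) ⊕ Bool → GadgetVertex V
    | .inl (.inl v) => .bar v
    | .inl (.inr v) => .hat v
    | .inr true => .win
    | .inr false => .lose
  have he : Function.Bijective e := by
    constructor
    · rintro ((a | a) | (_ | _)) ((b | b) | (_ | _)) h <;> simp_all [e]
    · rintro (v | v | _ | _)
      · exact ⟨.inl (.inl v), rfl⟩
      · exact ⟨.inl (.inr v), rfl⟩
      · exact ⟨.inr true, rfl⟩
      · exact ⟨.inr false, rfl⟩
  rw [← Function.Bijective.sum_comp he]
  simp [e, add_assoc]

/-- Owners in the gadget arena: the copy `bar v` belongs to the owner of `v`, all other vertices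
are random. -/
def gadgetOwner (G : StochasticArena V) : GadgetVertex V → Owner
  | .bar v => G.owner v
  | _ => .random

variable [DecidableEq V]

/-- The transition function of the gadget arena. -/
noncomputable def gadgetΔ (G : StochasticArena V) (p : V → ℕ) (α : ℕ → Set.Icc (0 : ℝ) 1) :
    GadgetVertex V → GadgetVertex V → ℝ
  | .bar u, .hat w => G.Δ u w
  | .hat u, .bar w => if u = w then 1 - (α (p u) : ℝ) else 0
  | .hat u, .win => if Even (p u) then (α (p u) : ℝ) else 0
  | .hat u, .lose => if Odd (p u) then (α (p u) : ℝ) else 0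
  | .win, .win => 1
  | .lose, .lose => 1
  | _, _ => 0

/-- The edges of the gadget arena. The edges out of `hat u` are present only if they have positive
probability, as the definition of an arena demands; this matters only if `α (p u)` is `0` or `1`. -/
def gadgetE (G : StochasticArena V) (p : V → ℕ) (α : ℕ → Set.Icc (0 : ℝ) 1) :
    GadgetVertex V → GadgetVertex V → Prop
  | .bar u, .hat w => G.E u w
  | .hat u, .bar w => u = w ∧ (α (p u) : ℝ) < 1
  | .hat u, .win => Even (p u) ∧ 0 < (α (p u) : ℝ)
  | .hat u, .lose => Odd (p u) ∧ 0 < (α (p u) : ℝ)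
  | .win, .win => True
  | .lose, .lose => True
  | _, _ => False

/-- The gadget arena: each move to `v` first leads to `hat v`, from where the play ends in a sink
with probability `α (p v)` (in `win` if `p v` is even, in `lose` if it is odd) and continues from
`bar v` otherwise. -/
noncomputable def gadget (G : StochasticArena V) (p : V → ℕ) (α : ℕ → Set.Icc (0 : ℝ) 1) :
    StochasticArena (GadgetVertex V) where
  E := G.gadgetE p α
  owner := G.gadgetOwner
  Δ := G.gadgetΔ p α
  Δ_nonneg := by
    intro u hu v
    have h0 := fun i => (α i).2.1
    have h1 := fun i => (α i).2.2
    cases u <;> cases v <;> simp only [gadgetΔ, gadgetOwner] at hu ⊢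
    case bar.hat u v => exact G.Δ_nonneg u hu v
    all_goals try split_ifs
    all_goals first
      | exact le_rfl
      | exact zero_le_one
      | exact h0 _
      | exact sub_nonneg.2 (h1 _)
  Δ_sum := by
    intro u hu
    rw [sum_gadgetVertex]
    cases u with
    | bar u => simpa [gadgetΔ] using G.Δ_sum u hu
    | hat u =>
      rcases Nat.even_or_odd (p u) with h | h
      · have h' : ¬ Odd (p u) := Nat.not_odd_iff_even.2 h
        simp [gadgetΔ, h, h']
      · have h' : ¬ Even (p u) := Nat.not_even_iff_odd.2 h
        simp [gadgetΔ, h, h']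
    | win => simp [gadgetΔ]
    | lose => simp [gadgetΔ]
  edge_iff := by
    intro u hu v
    cases u <;> cases v <;> simp only [gadgetΔ, gadgetE, gadgetOwner] at hu ⊢
    case bar.hat u v => exact G.edge_iff u hu v
    case hat.bar u v => by_cases h : u = v <;> simp [h]
    case hat.win u => by_cases h : Even (p u) <;> simp [h]
    case hat.lose u => by_cases h : Odd (p u) <;> simp [h]
    all_goals simp
  nonblocking := by
    intro u
    cases u with
    | bar u => exact (G.nonblocking u).imp' GadgetVertex.hat fun _ h => h
    | hat u =>
      by_cases h1 : (α (p u) : ℝ) < 1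
      · exact ⟨.bar u, rfl, h1⟩
      · have h0 : 0 < (α (p u) : ℝ) := zero_lt_one.trans_le (not_lt.1 h1)
        rcases Nat.even_or_odd (p u) with h | h
        · exact ⟨.win, h, h0⟩
        · exact ⟨.lose, h, h0⟩
    | win => exact ⟨.win, trivial⟩
    | lose => exact ⟨.lose, trivial⟩

/-- A strategy of Eve, seen as a strategy in the gadget arena. -/
def EveStrategy.lift {G : StochasticArena V} (σ : G.EveStrategy) (p : V → ℕ)
    (α : ℕ → Set.Icc (0 : ℝ) 1) : (G.gadget p α).EveStrategy
  | ⟨.bar u, h⟩ => ⟨.hat (σ ⟨u, h⟩), (σ ⟨u, h⟩).2⟩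
  | ⟨.hat _, h⟩ => nomatch h
  | ⟨.win, h⟩ => nomatch h
  | ⟨.lose, h⟩ => nomatch h

/-- A strategy of Adam, seen as a strategy in the gadget arena. -/
def AdamStrategy.lift {G : StochasticArena V} (γ : G.AdamStrategy) (p : V → ℕ)
    (α : ℕ → Set.Icc (0 : ℝ) 1) : (G.gadget p α).AdamStrategy
  | ⟨.bar u, h⟩ => ⟨.hat (γ ⟨u, h⟩), (γ ⟨u, h⟩).2⟩
  | ⟨.hat _, h⟩ => nomatch h
  | ⟨.win, h⟩ => nomatch h
  | ⟨.lose, h⟩ => nomatch h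

/-- The Markov chain of the gadget arena under a pair of pure memoryless strategies of `G`. -/
noncomputable def gadgetChain (G : StochasticArena V) (p : V → ℕ) (α : ℕ → Set.Icc (0 : ℝ) 1)
    (σ : G.EveStrategy) (γ : G.AdamStrategy) : MarkovChain (GadgetVertex V) :=
  (G.gadget p α).chain (σ.lift p α) (γ.lift p α)

/-- The two copies of the vertices of `U`; the pBSCC associated with `U` if `U` is a BSCC. -/
def pBSCC (U : Finset V) : Finset (GadgetVertex V) :=
  U.image GadgetVertex.bar ∪ U.image GadgetVertex.hat

theorem pBSCC_nonempty {W : Type*} [DecidableEq W] {U : Finset W} (hU : (U : Set W).Nonempty) :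
    (pBSCC U).Nonempty := by
  obtain ⟨v, hv⟩ := hU
  exact ⟨.bar v, Finset.mem_union_left _ (Finset.mem_image_of_mem _ hv)⟩

/-- The minimum probability of reaching `win` from a vertex of the pBSCC associated with `U`. -/
noncomputable def minWinProb (G : StochasticArena V) (p : V → ℕ) (α : ℕ → Set.Icc (0 : ℝ) 1)
    (σ : G.EveStrategy) (γ : G.AdamStrategy) (U : Finset V) (hU : (G.chain σ γ).IsBSCC U) : ℝ :=
  (pBSCC U).inf' (pBSCC_nonempty hU.1.1)
    fun x => (G.gadgetChain p α σ γ).reachProb x {GadgetVertex.win}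

/-- The maximum probability of reaching `win` from a vertex of the pBSCC associated with `U`. -/
noncomputable def maxWinProb (G : StochasticArena V) (p : V → ℕ) (α : ℕ → Set.Icc (0 : ℝ) 1)
    (σ : G.EveStrategy) (γ : G.AdamStrategy) (U : Finset V) (hU : (G.chain σ γ).IsBSCC U) : ℝ :=
  (pBSCC U).sup' (pBSCC_nonempty hU.1.1)
    fun x => (G.gadgetChain p α σ γ).reachProb x {GadgetVertex.win}

end StochasticArena

/-- The bound, for `n` vertices, least transition probability `d`, `a = α k` and
`b = α (k + 1)`. -/
noncomputable def winBound (n : ℕ) (d a b : ℝ) : ℝ :=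
  let x₂ := d * (1 - b)
  let x₃ := (1 - d) * (1 - b)
  let x₄ := d * a
  let x₅ := d * (1 - a) + (1 - d) * (1 - b)
  let t := x₃
  (1 - b) * (((1 - x₂) * x₂ ^ (n - 1) * x₄) /
    (1 - (x₂ + x₃) + x₅ * x₂ ^ n + t * x₂ ^ (n - 1) - x₅ * x₂ ^ (n - 1)))

/-! ### Reachability probabilities in finite Markov chains -/

namespace MarkovChain

variable {S : Type*} [Fintype S]

/-! Let `k` be the least priority of the BSCC, `v` a vertex carrying it, `a = α k`, `b = α (k + 1)`,
and let the good sink be `win` for even `k`, `lose` for odd `k`. Write `q u`, `h u` for the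
probabilities of reaching the good sink from `bar u`, `hat u`. A vertex whose parity differs from
that of `k` has priority at least `k + 1`, so its gadget loses at most a fraction `b`; hence `h ≥ (1
- b) q` throughout, while `h v = a + (1 - a) q v`.

Let `c` be the minimum of `q` on the component, attained at `x`. Some path of at most `n` steps
leads from `x` to `v`, and each step has probability at least `d = deltaMin`. Bounding `q` backwards
along it, with `c` used for all deviations, gives the affine recursion `distBound`, and so an
inequality `distBound … c j ≤ c` with `j < n`. Solved for `c`, it says that `(1 - b) * c` is at
least `winBound` (`winBound_le`). The argument is carried out for an abstract chain in
`winBound_le_of_isBSCC`. For odd `k` it bounds the probability of `lose`, and the two sinks share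
total probability at most `1`. -/

theorem reachProb_nonneg (M : MarkovChain S) (s : S) (T : Set S) : 0 ≤ M.reachProb s T :=
  tsum_nonneg (M.hitProb_nonneg s T)

theorem reachProb_le_one (M : MarkovChain S) (s : S) (T : Set S) : M.reachProb s T ≤ 1 :=
  Real.tsum_le_of_sum_range_le (M.hitProb_nonneg s T) fun N => M.sum_hitProb_le_one T N s

theorem reachProb_of_mem (M : MarkovChain S) {s : S} {T : Set S} (hs : s ∈ T) :
    M.reachProb s T = 1 := by
  classical
  unfold reachProb
  rw [(M.summable_hitProb s T).tsum_eq_zero_add, hitProb_zero]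
  simp [hitProb_succ, hs]

theorem reachProb_of_notMem (M : MarkovChain S) {s : S} {T : Set S} (hs : s ∉ T) :
    M.reachProb s T = ∑ t, M.δ s t * M.reachProb t T := by
  classical
  unfold reachProb
  rw [(M.summable_hitProb s T).tsum_eq_zero_add, hitProb_zero]
  simp only [hitProb_succ, hs, if_false, zero_add]
  rw [Summable.tsum_finsetSum fun t _ => (M.summable_hitProb t T).mul_left _]
  simp only [tsum_mul_left]

/-- From an absorbing state, no other state is reached. -/
theorem hitProb_of_absorbing (M : MarkovChain S) {s : S} {T : Set S} (hs : M.δ s s = 1)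
    (hT : s ∉ T) (n : ℕ) : M.hitProb s T n = 0 := by
  classical
  have h0 : ∀ t, t ≠ s → M.δ s t = 0 := by
    have h := M.δ_sum s
    rw [← Finset.add_sum_erase _ _ (Finset.mem_univ s), hs, add_eq_left,
      Finset.sum_eq_zero_iff_of_nonneg fun t _ => M.δ_nonneg s t] at h
    intro t ht
    exact h t (Finset.mem_erase.2 ⟨ht, Finset.mem_univ t⟩)
  induction n with
  | zero => simp [hitProb_zero, hT]
  | succ n ih =>
    rw [hitProb_succ, if_neg hT]
    refine Finset.sum_eq_zero fun t _ => ?_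
    by_cases ht : t = s
    · rw [ht, ih, mul_zero]
    · rw [h0 t ht, zero_mul]

/-- Two distinct absorbing states are reached with total probability at most one. -/
theorem reachProb_add_reachProb_le_one (M : MarkovChain S) {x y : S} (hxy : x ≠ y)
    (hx : M.δ x x = 1) (hy : M.δ y y = 1) (s : S) :
    M.reachProb s {x} + M.reachProb s {y} ≤ 1 := by
  classical
  have key : ∀ N s, ∑ n ∈ Finset.range N, (M.hitProb s {x} n + M.hitProb s {y} n) ≤ 1 := by
    intro N
    induction N with
    | zero => intro s; simp
    | succ N ih =>
      intro s
      by_cases hsx : s = x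
      · have h : s ∉ ({y} : Set S) := by simpa [hsx] using hxy
        simp only [M.hitProb_of_absorbing (hsx ▸ hx) h, add_zero]
        exact M.sum_hitProb_le_one _ _ _
      by_cases hsy : s = y
      · have h : s ∉ ({x} : Set S) := by simpa [hsy] using hxy.symm
        simp only [M.hitProb_of_absorbing (hsy ▸ hy) h, zero_add]
        exact M.sum_hitProb_le_one _ _ _
      rw [Finset.sum_range_succ']
      simp only [hitProb_zero, hitProb_succ, Set.mem_singleton_iff, hsx, hsy, if_false, add_zero,
        ← Finset.sum_add_distrib, ← mul_add]
      rw [Finset.sum_comm, ← M.δ_sum s]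
      refine Finset.sum_le_sum fun t _ => ?_
      rw [← Finset.mul_sum]
      exact mul_le_of_le_one_right (M.δ_nonneg s t) (ih t)
  unfold reachProb
  rw [← (M.summable_hitProb s _).tsum_add (M.summable_hitProb s _)]
  exact Real.tsum_le_of_sum_range_le
    (fun n => add_nonneg (M.hitProb_nonneg _ _ _) (M.hitProb_nonneg _ _ _)) fun N => key N s

/-! ### Bounded path lengths -/

open Classical in
/-- The states from which `v` can be reached by at least one and at most `i + 1` steps. -/
noncomputable def stepsTo (M : MarkovChain S) (v : S) : ℕ → Finset S
  | 0 => {u | M.Step u v}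
  | i + 1 => stepsTo M v i ∪ Finset.univ.filter fun u => ∃ w ∈ stepsTo M v i, M.Step u w

theorem transGen_mem_of_closed {M : MarkovChain S} {u v : S} {A : Set S}
    (h0 : ∀ u, M.Step u v → u ∈ A) (h1 : ∀ u, ∀ w ∈ A, M.Step u w → u ∈ A)
    (h : Relation.TransGen M.Step u v) : u ∈ A := by
  induction h using Relation.TransGen.head_induction_on with
  | single h => exact h0 _ h
  | head h _ ih => exact h1 _ _ ih h

theorem step_mem_stepsTo (M : MarkovChain S) {u v : S} (h : M.Step u v) (i : ℕ) :
    u ∈ M.stepsTo v i := by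
  classical
  induction i with
  | zero => simpa [stepsTo] using h
  | succ i ih => exact Finset.mem_union_left _ ih

/-- A state that can be reached at all is reached within as many steps as there are states. -/
theorem transGen_mem_stepsTo (M : MarkovChain S) {u v : S} (h : Relation.TransGen M.Step u v) :
    u ∈ M.stepsTo v (Fintype.card S - 1) := by
  classical
  have hpos : 0 < Fintype.card S := Fintype.card_pos_iff.2 ⟨u⟩
  -- Until `u` appears, every round adds a state: a round that adds nothing leaves a set closed
  -- under predecessors, which must contain `u`.
  have key : ∀ i, u ∈ M.stepsTo v i ∨ i + 1 ≤ (M.stepsTo v i).card := by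
    intro i
    induction i with
    | zero =>
      right
      obtain ⟨w, -, hw⟩ := (Relation.TransGen.tail'_iff.1 h)
      exact Finset.card_pos.2 ⟨w, M.step_mem_stepsTo hw 0⟩
    | succ i ih =>
      rcases ih with ih | ih
      · exact Or.inl (Finset.mem_union_left _ ih)
      by_cases heq : M.stepsTo v (i + 1) = M.stepsTo v i
      · left
        refine transGen_mem_of_closed (A := M.stepsTo v (i + 1))
          (fun u hu => M.step_mem_stepsTo hu _) (fun u w hw huw => ?_) h
        rw [heq] at hw
        refine Finset.mem_union_right _ ?_
        simpa using ⟨w, hw, huw⟩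
      · right
        have : M.stepsTo v i ⊂ M.stepsTo v (i + 1) :=
          (Finset.subset_union_left).ssubset_of_ne (Ne.symm heq)
        have := Finset.card_lt_card this
        omega
  rcases key (Fintype.card S - 1) with h | h
  · exact h
  · have : M.stepsTo v (Fintype.card S - 1) = Finset.univ :=
      Finset.eq_univ_of_card _ (le_antisymm (Finset.card_le_univ _) (by omega))
    rw [this]
    exact Finset.mem_univ u

end MarkovChain

/-! ### The recursion along a path and its closed form -/

/-- The iteration behind `winBound`: the bound at distance `i + 1` from the target, where `c` is a
lower bound that holds everywhere. -/
noncomputable def distBound (d a b c : ℝ) : ℕ → ℝ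
  | 0 => d * a + (d * (1 - a) + (1 - d) * (1 - b)) * c
  | i + 1 => d * (1 - b) * distBound d a b c i + (1 - d) * (1 - b) * c

/-- Unrolling the recursion yields a geometric sum. The factor `1 - d * (1 - b)` is kept on the left
because it vanishes when `d = 1` and `b = 0`. -/
theorem distBound_mul (d a b c : ℝ) (i : ℕ) :
    distBound d a b c i * (1 - d * (1 - b)) =
      (d * (1 - b)) ^ i * (d * a + (d * (1 - a) + (1 - d) * (1 - b)) * c) * (1 - d * (1 - b)) +
        (1 - d) * (1 - b) * c * (1 - (d * (1 - b)) ^ i) := by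
  induction i with
  | zero => simp [distBound]
  | succ i ih =>
    rw [distBound, add_mul, mul_assoc _ (distBound d a b c i), ih]
    ring

/-- The case `c = 1` serves to show that the denominator of `winBound` is nonnegative. -/
theorem distBound_one_le_one {d a b : ℝ} (hd0 : 0 ≤ d) (hd1 : d ≤ 1) (hb0 : 0 ≤ b) (hb1 : b ≤ 1)
    (i : ℕ) : distBound d a b 1 i ≤ 1 := by
  have h1 : 0 ≤ (1 - d) * b := mul_nonneg (by linarith) hb0
  have h2 : 0 ≤ d * (1 - b) := mul_nonneg hd0 (by linarith)
  induction i with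
  | zero => rw [distBound]; linarith
  | succ i ih =>
    rw [distBound]
    have := mul_le_mul_of_nonneg_left ih h2
    linarith

/-- Once the bound is at most `c`, one more step makes it at most `(1 - b) * c ≤ c`. Thus the
unknown path length can be replaced by the worst case. -/
theorem distBound_le_of_le {d a b c : ℝ} (hd0 : 0 ≤ d) (hb0 : 0 ≤ b) (hb1 : b ≤ 1) (hc : 0 ≤ c)
    {i j : ℕ} (hij : i ≤ j) (h : distBound d a b c i ≤ c) : distBound d a b c j ≤ c := by
  induction j, hij using Nat.le_induction with
  | base => exact h
  | succ j _ ih =>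
    rw [distBound]
    have h1 := mul_le_mul_of_nonneg_left ih (mul_nonneg hd0 (sub_nonneg.2 hb1))
    have h2 := mul_nonneg hb0 hc
    linarith

/-- By the closed form, the hypothesis is linear in `c`: the numerator in `winBound` is at most `c`
times the denominator. -/
theorem winBound_le {n : ℕ} (hn : 0 < n) {d a b c : ℝ} (hd0 : 0 ≤ d) (hd1 : d ≤ 1)
    (ha0 : 0 ≤ a) (hb0 : 0 ≤ b) (hb1 : b ≤ 1) (hc : 0 ≤ c) (h : distBound d a b c (n - 1) ≤ c) :
    winBound n d a b ≤ (1 - b) * c := by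
  obtain ⟨m, rfl⟩ := Nat.exists_eq_succ_of_ne_zero hn.ne'
  simp only [Nat.succ_eq_add_one, Nat.add_sub_cancel] at h
  unfold winBound
  simp only [Nat.succ_eq_add_one, Nat.add_sub_cancel]
  refine mul_le_mul_of_nonneg_left ?_ (sub_nonneg.2 hb1)
  have hx : 0 ≤ 1 - d * (1 - b) := by
    have := mul_nonneg hd0 hb0
    linarith
  have e := distBound_mul d a b c m
  have l := mul_le_mul_of_nonneg_right h hx
  have e1 := distBound_mul d a b 1 m
  have l1 := mul_le_mul_of_nonneg_right (distBound_one_le_one (a := a) hd0 hd1 hb0 hb1 m) hx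
  have h0 := mul_nonneg (mul_nonneg hx (pow_nonneg (mul_nonneg hd0 (sub_nonneg.2 hb1)) m))
    (mul_nonneg hd0 ha0)
  -- Only a nonnegative denominator is needed, since division by zero gives `0`. Its sign comes from
  -- `c = 1`, the remaining inequality from the given `c`.
  refine div_le_of_le_mul₀ ?_ hc ?_ <;> rw [pow_succ]
  · linarith
  · linarith

/-! ### The lower bound in a bottom component -/

namespace MarkovChain

variable {S : Type*} [Fintype S]

/-- In a bottom component, an expected value dominates any two-point lower bound. -/
theorem le_sum_δ_mul (M : MarkovChain S) {u w : S} {d m : ℝ} {U : Set S} {h : S → ℝ}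
    (hU : ∀ t, t ∉ U → ¬ M.Step u t) (hm : ∀ t ∈ U, m ≤ h t) (hw : w ∈ U) (hd : d ≤ M.δ u w) :
    d * h w + (1 - d) * m ≤ ∑ t, M.δ u t * h t := by
  classical
  have h1 : M.δ u w * (h w - m) ≤ ∑ t, M.δ u t * (h t - m) := by
    refine Finset.single_le_sum (f := fun t => M.δ u t * (h t - m)) (fun t _ => ?_)
      (Finset.mem_univ w)
    by_cases ht : t ∈ U
    · exact mul_nonneg (M.δ_nonneg _ _) (sub_nonneg.2 (hm t ht))
    · have : M.δ u t = 0 := le_antisymm (not_lt.1 (hU t ht)) (M.δ_nonneg _ _)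
      simp [this]
  have h2 : ∑ t, M.δ u t * (h t - m) = ∑ t, M.δ u t * h t - m := by
    simp only [mul_sub, Finset.sum_sub_distrib, ← Finset.sum_mul, M.δ_sum, one_mul]
  have h3 := mul_le_mul_of_nonneg_right hd (sub_nonneg.2 (hm w hw))
  linarith

/-- Let `h` be the values before, and `q` the values after, leaving the play with a small
probability. If leaving at `v` earns `1` with probability `a`, and leaving elsewhere costs at most
a fraction `b`, then all values are bounded from below. -/
theorem winBound_le_of_isBSCC (M : MarkovChain S) {U : Finset S} (hU : M.IsBSCC U)
    {d a b : ℝ} (hd0 : 0 ≤ d) (hd1 : d ≤ 1) (hb0 : 0 ≤ b) (hb1 : b ≤ 1) (ha0 : 0 ≤ a)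
    (ha1 : a ≤ 1) (hd : ∀ u w, M.Step u w → d ≤ M.δ u w) {q h : S → ℝ} (hq0 : ∀ u ∈ U, 0 ≤ q u)
    (hq : ∀ u ∈ U, q u = ∑ w, M.δ u w * h w) (hh : ∀ u ∈ U, (1 - b) * q u ≤ h u)
    {v : S} (hv : v ∈ U) (hhv : a + (1 - a) * q v ≤ h v) :
    ∀ u ∈ U, winBound (Fintype.card S) d a b ≤ q u ∧ winBound (Fintype.card S) d a b ≤ h u := by
  classical
  obtain ⟨x, hx, hmin⟩ := U.exists_min_image q ⟨v, hv⟩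
  have hc := hq0 x hx
  have hm : ∀ t ∈ (U : Set S), (1 - b) * q x ≤ h t := fun t ht =>
    (mul_le_mul_of_nonneg_left (hmin t ht) (sub_nonneg.2 hb1)).trans (hh t ht)
  have hmem : ∀ u ∈ U, ∀ w, M.Step u w → w ∈ U := fun u hu w huw =>
    by_contra fun hw => hU.2 u hu w hw huw
  have hstep : ∀ u ∈ U, ∀ w, M.Step u w → d * h w + (1 - d) * ((1 - b) * q x) ≤ q u := by
    intro u hu w huw
    rw [hq u hu]
    exact M.le_sum_δ_mul (hU.2 u hu) hm (hmem u hu w huw) (hd u w huw)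
  -- `stepsTo` is cumulative, so only some `j ≤ i` is obtained; index `j` stands for a path of `j +
  -- 1` steps.
  have hdist : ∀ i, ∀ u ∈ U, u ∈ M.stepsTo v i → ∃ j ≤ i, distBound d a b (q x) j ≤ q u := by
    intro i
    induction i with
    | zero =>
      intro u hu huv
      refine ⟨0, le_rfl, le_trans ?_ (hstep u hu v (by simpa [stepsTo] using huv))⟩
      have h1 := mul_le_mul_of_nonneg_left (hmin v hv) (sub_nonneg.2 ha1)
      have h2 := mul_le_mul_of_nonneg_left ((add_le_add_right h1 a).trans hhv) hd0
      rw [distBound]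
      linarith
    | succ i ih =>
      intro u hu huv
      rw [stepsTo, Finset.mem_union] at huv
      rcases huv with huv | huv
      · obtain ⟨j, hj, h⟩ := ih u hu huv
        exact ⟨j, hj.trans i.le_succ, h⟩
      obtain ⟨w, hw, huw⟩ := (Finset.mem_filter.1 huv).2
      have hwU := hmem u hu w huw
      obtain ⟨j, hj, hjw⟩ := ih w hwU hw
      refine ⟨j + 1, Nat.succ_le_succ hj, le_trans ?_ (hstep u hu w huw)⟩
      have h1 := mul_le_mul_of_nonneg_left hjw (sub_nonneg.2 hb1)
      have h2 := mul_le_mul_of_nonneg_left (h1.trans (hh w hwU)) hd0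
      rw [distBound]
      linarith
  -- Strong connectivity supplies a path with at least one step even if `x = v`, as the base case of
  -- `distBound` requires.
  obtain ⟨j, hj, hjx⟩ := hdist _ x hx (M.transGen_mem_stepsTo (hU.1.2.1 x hx v hv))
  have hB := winBound_le (Fintype.card_pos_iff.2 ⟨v⟩) hd0 hd1 ha0 hb0 hb1 hc
    (distBound_le_of_le hd0 hb0 hb1 hc hj hjx)
  intro u hu
  have h1 := mul_nonneg hb0 hc
  have h2 := hmin u hu
  exact ⟨by linarith, hB.trans (hm u hu)⟩

end MarkovChain

/-! ### The gadget chain and its one-step equations -/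

namespace StochasticArena

variable {V : Type*} [Fintype V]

theorem deltaMin_le_one (G : StochasticArena V) : G.deltaMin ≤ 1 :=
  Finset.min'_le _ _ (Finset.mem_insert_self _ _)

theorem deltaMin_nonneg (G : StochasticArena V) : 0 ≤ G.deltaMin := by
  refine Finset.le_min' _ _ _ fun y hy => ?_
  rcases Finset.mem_insert.1 hy with rfl | hy
  · exact zero_le_one
  · obtain ⟨e, he, rfl⟩ := Finset.mem_image.1 hy
    exact (Finset.mem_filter.1 he).2.2.le

variable [DecidableEq V]

theorem deltaMin_le_chain_δ (G : StochasticArena V) (σ : G.EveStrategy) (γ : G.AdamStrategy)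
    (u w : V) (h : (G.chain σ γ).Step u w) : G.deltaMin ≤ (G.chain σ γ).δ u w := by
  change 0 < G.chainδ σ γ u w at h
  change _ ≤ G.chainδ σ γ u w
  unfold chainδ at h ⊢
  split_ifs at h ⊢ with h₁ h₂ h₃ h₄
  · exact G.deltaMin_le_one
  · exact absurd h (lt_irrefl _)
  · exact G.deltaMin_le_one
  · exact absurd h (lt_irrefl _)
  · refine Finset.min'_le _ _ (Finset.mem_insert_of_mem (Finset.mem_image.2 ⟨(u, w), ?_, rfl⟩))
    exact Finset.mem_filter.2 ⟨Finset.mem_univ _, G.owner_random ‹_› ‹_›, h⟩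

variable (G : StochasticArena V) (p : V → ℕ) (α : ℕ → Set.Icc (0 : ℝ) 1)
  (σ : G.EveStrategy) (γ : G.AdamStrategy)

theorem gadgetChain_δ_bar (u : V) (y : GadgetVertex V) : (G.gadgetChain p α σ γ).δ (.bar u) y =
    match y with | .hat w => (G.chain σ γ).δ u w | _ => 0 := by
  change (G.gadget p α).chainδ _ _ _ _ = _
  have ho : (G.gadget p α).owner (.bar u) = G.owner u := rfl
  unfold chainδ
  by_cases h : G.owner u = .eve
  · rw [dif_pos (ho.trans h)]
    cases y <;> simp [EveStrategy.lift, chain, chainδ, h]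
  · rw [dif_neg (fun h' => h (ho.symm.trans h'))]
    by_cases h1 : G.owner u = .adam
    · rw [dif_pos (ho.trans h1)]
      cases y <;> simp [AdamStrategy.lift, chain, chainδ, h1]
    · rw [dif_neg (fun h' => h1 (ho.symm.trans h'))]
      cases y <;> simp [gadget, gadgetΔ, chain, chainδ, h, h1]

theorem gadgetChain_δ_of_random {x : GadgetVertex V} (hx : G.gadgetOwner x = .random)
    (y : GadgetVertex V) : (G.gadgetChain p α σ γ).δ x y = G.gadgetΔ p α x y := by
  change (G.gadget p α).chainδ _ _ _ _ = _
  have ho : (G.gadget p α).owner x = .random := hx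
  unfold chainδ
  rw [dif_neg (by rw [ho]; decide), dif_neg (by rw [ho]; decide)]
  rfl

theorem reachProb_bar (u : V) {s : GadgetVertex V} (hs : s = .win ∨ s = .lose) :
    (G.gadgetChain p α σ γ).reachProb (.bar u) {s} =
      ∑ w, (G.chain σ γ).δ u w * (G.gadgetChain p α σ γ).reachProb (.hat w) {s} := by
  rw [MarkovChain.reachProb_of_notMem _ (by rcases hs with rfl | rfl <;> simp), sum_gadgetVertex]
  simp [gadgetChain_δ_bar]

theorem gadgetChain_δ_win : (G.gadgetChain p α σ γ).δ .win .win = 1 :=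
  gadgetChain_δ_of_random G p α σ γ rfl _

theorem gadgetChain_δ_lose : (G.gadgetChain p α σ γ).δ .lose .lose = 1 :=
  gadgetChain_δ_of_random G p α σ γ rfl _

theorem reachProb_sink {x y : GadgetVertex V} (h : x ≠ y) (hx : (G.gadgetChain p α σ γ).δ x x = 1) :
    (G.gadgetChain p α σ γ).reachProb x {y} = 0 := by
  simp [MarkovChain.reachProb, MarkovChain.hitProb_of_absorbing _ hx (T := {y}) (by simpa using h)]

theorem reachProb_hat_win (u : V) :
    (G.gadgetChain p α σ γ).reachProb (.hat u) {.win} = (if Even (p u) then (α (p u) : ℝ) else 0) +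
      (1 - α (p u)) * (G.gadgetChain p α σ γ).reachProb (.bar u) {.win} := by
  rw [MarkovChain.reachProb_of_notMem _ (by simp), sum_gadgetVertex,
    MarkovChain.reachProb_of_mem _ (Set.mem_singleton _),
    G.reachProb_sink p α σ γ (by simp) (G.gadgetChain_δ_lose p α σ γ)]
  simp [gadgetChain_δ_of_random G p α σ γ (x := .hat u) rfl, gadgetΔ, add_comm]

theorem reachProb_hat_lose (u : V) :
    (G.gadgetChain p α σ γ).reachProb (.hat u) {.lose} = (if Odd (p u) then (α (p u) : ℝ) else 0) +
      (1 - α (p u)) * (G.gadgetChain p α σ γ).reachProb (.bar u) {.lose} := by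
  rw [MarkovChain.reachProb_of_notMem _ (by simp), sum_gadgetVertex,
    MarkovChain.reachProb_of_mem _ (Set.mem_singleton _),
    G.reachProb_sink p α σ γ (by simp) (G.gadgetChain_δ_win p α σ γ)]
  simp [gadgetChain_δ_of_random G p α σ γ (x := .hat u) rfl, gadgetΔ, add_comm]

variable {α}

/-- The bound holds for the sink `s` that is reached from the vertices whose priorities satisfy
`P`, if the least priority of the component satisfies `P`. -/
theorem winBound_le_reachProb (hα : Antitone α) {U : Finset V} (hU : (G.chain σ γ).IsBSCC U)
    {k : ℕ} (hk : IsLeast (p '' U) k) {s : GadgetVertex V} (hs : s = .win ∨ s = .lose)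
    (P : ℕ → Prop) [DecidablePred P] (hP : P k)
    (hhat : ∀ u, (G.gadgetChain p α σ γ).reachProb (.hat u) {s} =
      (if P (p u) then (α (p u) : ℝ) else 0) +
        (1 - α (p u)) * (G.gadgetChain p α σ γ).reachProb (.bar u) {s}) :
    ∀ x ∈ pBSCC U, winBound (Fintype.card V) G.deltaMin (α k) (α (k + 1)) ≤
      (G.gadgetChain p α σ γ).reachProb x {s} := by
  obtain ⟨⟨v, hv, hvk⟩, hleast⟩ := hk
  have key := (G.chain σ γ).winBound_le_of_isBSCC hU (d := G.deltaMin) (a := α k)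
    (b := α (k + 1)) G.deltaMin_nonneg G.deltaMin_le_one (α _).2.1 (α _).2.2 (α _).2.1 (α _).2.2
    (G.deltaMin_le_chain_δ σ γ)
    (q := fun u => (G.gadgetChain p α σ γ).reachProb (.bar u) {s})
    (h := fun u => (G.gadgetChain p α σ γ).reachProb (.hat u) {s})
    (fun u _ => MarkovChain.reachProb_nonneg _ _ _) (fun u _ => G.reachProb_bar p α σ γ u hs)
    (fun u hu => ?_) hv ?_
  · intro x hx
    rcases Finset.mem_union.1 hx with hx | hx <;> obtain ⟨u, hu, rfl⟩ := Finset.mem_image.1 hx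
    · exact (key u hu).1
    · exact (key u hu).2
  · have h0 := (G.gadgetChain p α σ γ).reachProb_nonneg (.bar u) {s}
    have h1 := (G.gadgetChain p α σ γ).reachProb_le_one (.bar u) {s}
    rw [hhat]
    by_cases hPu : P (p u)
    · rw [if_pos hPu]
      -- Here the gadget exits to `s` itself; as `q u ≤ 1`, this only helps, and `h u ≥ q u`.
      have h2 := mul_nonneg (α (p u)).2.1 (sub_nonneg.2 h1)
      have h3 := mul_nonneg (α (k + 1)).2.1 h0
      linarith
    · rw [if_neg hPu, zero_add]
      -- `P` separates `p u` from the minimum `k`, so `p u ≥ k + 1`, and monotonicity caps the loss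
      -- by `α (k + 1)`.
      have hne : k ≠ p u := fun h => hPu (h ▸ hP)
      have hle : k ≤ p u := hleast (Set.mem_image_of_mem p hu)
      have h2 : (α (p u) : ℝ) ≤ α (k + 1) := hα (by omega)
      exact mul_le_mul_of_nonneg_right (by linarith) h0
  · rw [hhat, hvk, if_pos hP]

end StochasticArena

theorem mainTheorem7 {V : Type*} [Fintype V] [DecidableEq V] (G : StochasticArena V) (p : V → ℕ)
    (α : ℕ → Set.Icc (0 : ℝ) 1) (hα : Antitone α)
    (σ : G.EveStrategy) (γ : G.AdamStrategy)
    (U : Finset V) (hU : (G.chain σ γ).IsBSCC U)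
    (k : ℕ) (hk : IsLeast (p '' U) k) :
    (Even k →
      winBound (Fintype.card V) G.deltaMin (α k) (α (k + 1)) ≤ G.minWinProb p α σ γ U hU) ∧
    (Odd k →
      G.maxWinProb p α σ γ U hU ≤
        1 - winBound (Fintype.card V) G.deltaMin (α k) (α (k + 1))) := by
  constructor
  · intro hev
    exact Finset.le_inf' _ _ (G.winBound_le_reachProb p σ γ hα hU hk (Or.inl rfl) Even hev
      (G.reachProb_hat_win p α σ γ))
  · intro hodd
    refine Finset.sup'_le _ _ fun x hx => ?_
    have h1 := G.winBound_le_reachProb p σ γ hα hU hk (Or.inr rfl) Odd hodd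
      (G.reachProb_hat_lose p α σ γ) x hx
    have h2 := (G.gadgetChain p α σ γ).reachProb_add_reachProb_le_one (x := .win) (y := .lose)
      (by simp) (G.gadgetChain_δ_win p α σ γ) (G.gadgetChain_δ_lose p α σ γ) x
    linarith
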